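/- Let $G$ be a countable discrete group. A unitary representation of $G$ is a homomorphism $\pi$ from $G$ to the unitary group of a complex Hilbert space $H_\pi$; it is regarded as a two-sorted structure $(H_\pi,+,\langle\cdot,\cdot\rangle,\pi(g):g\in G)$, whose second sort is the complex field. Terms of the Hilbert space sort are built from variables and $0$ by addition, multiplication by terms of the scalar sort, and the operators $\pi(g)$; terms of the scalar sort are built from variables, constants for the rational numbers, sums, products and inner products $\langle s,t\rangle$ of Hilbert space terms. Atomic formulas are $|\langle s,t\rangle|\le p$ and $|\langle s,t\rangle|\ge q$, where $s,t$ are Hilbert space terms and $p,q\ge 0$ are rational. Quantifier-free positive formulas are built from atomic formulas by $\wedge$ and $\vee$. An existential formula is $\exists \bar y\,\varphi$ with $\varphi$ a quantifier-free positive formula, where every quantified variable (of either sort) is bounded, $\|y\|\le r$ with $r>0$ rational. An approximation of a formula is obtained by relaxing all its bounds by positive rational amounts: $p$ is replaced by $p+\varepsilon$, $q$ by $\max(q-\varepsilon,0)$, and the bound $r$ of an existential quantifier by some rational $r'>r$ (each occurrence with its own $\varepsilon>0$ or $r'$). The structure of $\pi$ is existentially closed if, for every unitary representation $\eta$ of $G$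 extending $\pi$ (through an equivariant linear isometric embedding $H_\pi\to H_\eta$), whenever an existential formula with parameters from $H_\pi$ (and from $\mathbb C$) is true in the structure of $\eta$, each of its approximations is true in the structure of $\pi$. Let $\lambda_G$ be the left regular representation of $G$ on $\ell^2(G)$, $(\lambda_G(g)f)(h)=f(g^{-1}h)$, and let $\infty\lambda_G$ be the Hilbert direct sum of $\aleph_0$ copies of $\lambda_G$. Let $\Sigma_G$ be the set of existential sentences true in the structure of $\infty\lambda_G$, and $\Sigma_G^-$ the set of all approximations of sentences in $\Sigma_G$. **Proposition.** Suppose that $G$ is amenable, that is, there is a left-invariant mean on the bounded real-valued functions on $G$, and let $\pi$ be a unitary representation of $G$ whose structure is a model of $\Sigma_G^-$. Then the structure of $\pi$ is existentially closed. -/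

import Mathlib

universe u v w

noncomputable section

namespace HilbertRep

open scoped ENNReal

/-! ### Amenable groups -/

/-- A discrete group is amenable if there is a left-invariant mean on the bounded real-valued
functions on it: a positive normalised linear functional that does not change when a function `f`
is replaced by its left translate `h ↦ f (g⁻¹ * h)`. -/
def IsAmenable (G : Type u) [Group G] : Prop :=
  ∃ m : lp (fun _ : G => ℝ) ∞ →ₗ[ℝ] ℝ,
    m 1 = 1 ∧
    (∀ f : lp (fun _ : G => ℝ) ∞, (∀ h, 0 ≤ f h) → 0 ≤ m f) ∧
    ∀ (g : G) (f f' : lp (fun _ : G => ℝ) ∞), (∀ h, f' h = f (g⁻¹ * h)) → m f' = m f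

/-! ### Unitary representations, the regular representation and direct sums -/

/-- A unitary representation of the discrete group `G` on the complex inner product space `H`:
a homomorphism from `G` to the group of unitary operators of `H`. -/
abbrev UnitaryRep (G : Type u) [Group G] (H : Type v) [NormedAddCommGroup H]
    [InnerProductSpace ℂ H] : Type _ :=
  G →* (H ≃ₗᵢ[ℂ] H)

/-- `ℓ²(G)`. -/
abbrev L2 (G : Type u) : Type u := lp (fun _ : G => ℂ) 2

theorem memℓp_leftShift {G : Type u} [Group G] (g : G) (f : L2 G) :
    Memℓp (fun h : G => f (g⁻¹ * h)) 2 := by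
  have hf := lp.memℓp f
  rw [memℓp_gen_iff (by norm_num)] at hf ⊢
  exact (Equiv.mulLeft g⁻¹).summable_iff.2 hf

/-- The left shift by `g` on `ℓ²(G)`, `(g f)(h) = f (g⁻¹ h)`, as a unitary operator. -/
def leftShift {G : Type u} [Group G] (g : G) : L2 G ≃ₗᵢ[ℂ] L2 G where
  toFun f := ⟨fun h => f (g⁻¹ * h), memℓp_leftShift g f⟩
  invFun f := ⟨fun h => f (g⁻¹⁻¹ * h), memℓp_leftShift g⁻¹ f⟩
  map_add' _ _ := rfl
  map_smul' _ _ := rfl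
  left_inv f := by ext h; simp
  right_inv f := by ext h; simp
  norm_map' f := by
    rw [lp.norm_eq_tsum_rpow (by norm_num), lp.norm_eq_tsum_rpow (by norm_num)]
    congr 1
    exact (Equiv.mulLeft g⁻¹).tsum_eq (fun h => ‖f h‖ ^ (2 : ℝ≥0∞).toReal)

/-- The (left) regular representation `λ_G` of `G` on `ℓ²(G)`. -/
def regularRep (G : Type u) [Group G] : UnitaryRep G (L2 G) :=
  MonoidHom.mk' leftShift fun a b => by
    ext f h
    change f ((a * b)⁻¹ * h) = f (b⁻¹ * (a⁻¹ * h))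
    rw [mul_inv_rev, mul_assoc]

section DirectSum

variable {I : Type w} {H : I → Type v} [∀ i, NormedAddCommGroup (H i)]
  [∀ i, InnerProductSpace ℂ (H i)]

theorem memℓp_diag (U : ∀ i, H i ≃ₗᵢ[ℂ] H i) (x : lp H 2) : Memℓp (fun i => U i (x i)) 2 := by
  have hx := lp.memℓp x
  rw [memℓp_gen_iff (by norm_num)] at hx ⊢
  simpa using hx

/-- The unitary operator `(x_i) ↦ (U_i x_i)` of the Hilbert direct sum of the `H_i`. -/
def diagUnitary (U : ∀ i, H i ≃ₗᵢ[ℂ] H i) : lp H 2 ≃ₗᵢ[ℂ] lp H 2 where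
  toFun x := ⟨fun i => U i (x i), memℓp_diag U x⟩
  invFun x := ⟨fun i => (U i).symm (x i), memℓp_diag (fun i => (U i).symm) x⟩
  map_add' x y := by
    ext i
    exact map_add (U i) (x i) (y i)
  map_smul' c x := by
    ext i
    exact map_smul (U i) c (x i)
  left_inv x := by ext i; simp
  right_inv x := by ext i; simp
  norm_map' x := by
    rw [lp.norm_eq_tsum_rpow (by norm_num), lp.norm_eq_tsum_rpow (by norm_num)]
    congr 1
    exact tsum_congr fun i => by simp

/-- The direct sum of a family of unitary representations, on the Hilbert direct sum. -/
def directSum {G : Type u} [Group G] (π : ∀ i, UnitaryRep G (H i)) : UnitaryRep G (lp H 2) :=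
  MonoidHom.mk' (fun g => diagUnitary fun i => π i g) fun a b => by
    ext x i
    change π i (a * b) (x i) = π i a (π i b (x i))
    rw [map_mul]
    rfl

end DirectSum

/-- The space of `∞λ_G`, the Hilbert direct sum of `ℵ₀` copies of `ℓ²(G)`. -/
abbrev InfL2 (G : Type u) : Type u := lp (fun _ : ℕ => L2 G) 2

/-- `∞λ_G`, the direct sum of `ℵ₀` copies of the regular representation. -/
def infRegularRep (G : Type u) [Group G] : UnitaryRep G (InfL2 G) :=
  directSum fun _ : ℕ => regularRep G

/-! ### The two-sorted language `L_G`

The first sort is the Hilbert space, the second sort is the complex field. -/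

mutual

/-- Terms of the Hilbert space sort, with free variables `x_i` (`i < n`) of the Hilbert space sort
and `z_j` (`j < m`) of the scalar sort. -/
inductive HTerm (G : Type u) (n m : ℕ) : Type u
  | var (i : Fin n) : HTerm G n m
  | zero : HTerm G n m
  | add (s t : HTerm G n m) : HTerm G n m
  | smul (a : CTerm G n m) (t : HTerm G n m) : HTerm G n m
  | act (g : G) (t : HTerm G n m) : HTerm G n m

/-- Terms of the scalar sort; there is a constant for each rational number. -/
inductive CTerm (G : Type u) (n m : ℕ) : Type u
  | var (j : Fin m) : CTerm G n m
  | const (q : ℚ) : CTerm G n m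
  | add (a b : CTerm G n m) : CTerm G n m
  | mul (a b : CTerm G n m) : CTerm G n m
  | inner (s t : HTerm G n m) : CTerm G n m

end

/-- Positive formulas with free variables `x_i` (`i < n`) of the Hilbert space sort and `z_j`
(`j < m`) of the scalar sort: the closure of the atomic formulas `|⟨s, t⟩| ≤ p` and `|⟨s, t⟩| ≥ q`,
with `p, q` non-negative rational numbers, under conjunction, disjunction and the bounded
quantifiers `∃ y, ‖y‖ ≤ r ∧ …` and `∀ y, ‖y‖ ≤ r → …` over both sorts, with `r` a positive
rational number. The quantified variable is the last one of its sort. -/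
inductive Formula (G : Type u) : ℕ → ℕ → Type u
  | innerLe {n m : ℕ} (s t : HTerm G n m) (p : ℚ≥0) : Formula G n m
  | innerGe {n m : ℕ} (s t : HTerm G n m) (q : ℚ≥0) : Formula G n m
  | and {n m : ℕ} (φ ψ : Formula G n m) : Formula G n m
  | or {n m : ℕ} (φ ψ : Formula G n m) : Formula G n m
  | exH {n m : ℕ} (r : {r : ℚ // 0 < r}) (φ : Formula G (n + 1) m) : Formula G n m
  | allH {n m : ℕ} (r : {r : ℚ // 0 < r}) (φ : Formula G (n + 1) m) : Formula G n m
  | exC {n m : ℕ} (r : {r : ℚ // 0 < r}) (φ : Formula G n (m + 1)) : Formula G n m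
  | allC {n m : ℕ} (r : {r : ℚ // 0 < r}) (φ : Formula G n (m + 1)) : Formula G n m

/-- Quantifier-free positive formulas. -/
inductive Formula.IsQF {G : Type u} : {n m : ℕ} → Formula G n m → Prop
  | innerLe {n m : ℕ} (s t : HTerm G n m) (p : ℚ≥0) : IsQF (.innerLe s t p)
  | innerGe {n m : ℕ} (s t : HTerm G n m) (q : ℚ≥0) : IsQF (.innerGe s t q)
  | and {n m : ℕ} {φ ψ : Formula G n m} : IsQF φ → IsQF ψ → IsQF (.and φ ψ)
  | or {n m : ℕ} {φ ψ : Formula G n m} : IsQF φ → IsQF ψ → IsQF (.or φ ψ)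

/-- Existential formulas: a block of bounded existential quantifiers in front of a quantifier-free
positive formula. -/
inductive Formula.IsExistential {G : Type u} : {n m : ℕ} → Formula G n m → Prop
  | qf {n m : ℕ} {φ : Formula G n m} : φ.IsQF → IsExistential φ
  | exH {n m : ℕ} (r : {r : ℚ // 0 < r}) {φ : Formula G (n + 1) m} :
      IsExistential φ → IsExistential (.exH r φ)
  | exC {n m : ℕ} (r : {r : ℚ // 0 < r}) {φ : Formula G n (m + 1)} :
      IsExistential φ → IsExistential (.exC r φ)

/-- `φ.Approx φ'` means that `φ'` is an approximation of `φ`: every bound in `φ` is relaxed by some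
positive rational amount. A lower bound is decreased to `q - ε`, where the subtraction of
non-negative rationals is truncated at `0`, as `|⟨s, t⟩| ≥ 0` is always true. -/
inductive Formula.Approx {G : Type u} : {n m : ℕ} → Formula G n m → Formula G n m → Prop
  | innerLe {n m : ℕ} (s t : HTerm G n m) (p : ℚ≥0) {ε : ℚ≥0} (hε : 0 < ε) :
      Approx (.innerLe s t p) (.innerLe s t (p + ε))
  | innerGe {n m : ℕ} (s t : HTerm G n m) (q : ℚ≥0) {ε : ℚ≥0} (hε : 0 < ε) :
      Approx (.innerGe s t q) (.innerGe s t (q - ε))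
  | and {n m : ℕ} {φ φ' ψ ψ' : Formula G n m} :
      Approx φ φ' → Approx ψ ψ' → Approx (.and φ ψ) (.and φ' ψ')
  | or {n m : ℕ} {φ φ' ψ ψ' : Formula G n m} :
      Approx φ φ' → Approx ψ ψ' → Approx (.or φ ψ) (.or φ' ψ')
  | exH {n m : ℕ} {r r' : {r : ℚ // 0 < r}} (hr : r < r') {φ φ' : Formula G (n + 1) m} :
      Approx φ φ' → Approx (.exH r φ) (.exH r' φ')
  | allH {n m : ℕ} {r r' : {r : ℚ // 0 < r}} (hr : r' < r) {φ φ' : Formula G (n + 1) m} :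
      Approx φ φ' → Approx (.allH r φ) (.allH r' φ')
  | exC {n m : ℕ} {r r' : {r : ℚ // 0 < r}} (hr : r < r') {φ φ' : Formula G n (m + 1)} :
      Approx φ φ' → Approx (.exC r φ) (.exC r' φ')
  | allC {n m : ℕ} {r r' : {r : ℚ // 0 < r}} (hr : r' < r) {φ φ' : Formula G n (m + 1)} :
      Approx φ φ' → Approx (.allC r φ) (.allC r' φ')

section Semantics

variable {G : Type u} [Group G] {H : Type v} [NormedAddCommGroup H] [InnerProductSpace ℂ H]

mutual

/-- The value in `(H, π)` of a term of the Hilbert space sort at `x`, `z`. -/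
def HTerm.eval (π : UnitaryRep G H) {n m : ℕ} (x : Fin n → H) (z : Fin m → ℂ) : HTerm G n m → H
  | .var i => x i
  | .zero => 0
  | .add s t => s.eval π x z + t.eval π x z
  | .smul a t => (a.eval π x z).down • t.eval π x z
  | .act g t => π g (t.eval π x z)

/-- The value in `(H, π)` of a term of the scalar sort at `x`, `z`, a complex number (lifted to the
universe of `H`, because the two mutually recursive functions must have values in one universe). -/
def CTerm.eval (π : UnitaryRep G H) {n m : ℕ} (x : Fin n → H) (z : Fin m → ℂ) :
    CTerm G n m → ULift.{v} ℂ
  | .var j => ⟨z j⟩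
  | .const q => ⟨(q : ℂ)⟩
  | .add a b => ⟨(a.eval π x z).down + (b.eval π x z).down⟩
  | .mul a b => ⟨(a.eval π x z).down * (b.eval π x z).down⟩
  | .inner s t => ⟨inner ℂ (s.eval π x z) (t.eval π x z)⟩

end

/-- Truth of a positive formula in the structure `(H, +, ⟨,⟩, π(g) : g ∈ G)` at `x`, `z`. -/
def Formula.Realize (π : UnitaryRep G H) :
    {n m : ℕ} → Formula G n m → (Fin n → H) → (Fin m → ℂ) → Prop
  | _, _, .innerLe s t p, x, z => ‖inner ℂ (s.eval π x z) (t.eval π x z)‖ ≤ (p : ℝ)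
  | _, _, .innerGe s t q, x, z => (q : ℝ) ≤ ‖inner ℂ (s.eval π x z) (t.eval π x z)‖
  | _, _, .and φ ψ, x, z => φ.Realize π x z ∧ ψ.Realize π x z
  | _, _, .or φ ψ, x, z => φ.Realize π x z ∨ ψ.Realize π x z
  | _, _, .exH r φ, x, z => ∃ y : H, ‖y‖ ≤ (r.1 : ℝ) ∧ φ.Realize π (Fin.snoc x y) z
  | _, _, .allH r φ, x, z => ∀ y : H, ‖y‖ ≤ (r.1 : ℝ) → φ.Realize π (Fin.snoc x y) z
  | _, _, .exC r φ, x, z => ∃ c : ℂ, ‖c‖ ≤ (r.1 : ℝ) ∧ φ.Realize π x (Fin.snoc z c)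
  | _, _, .allC r φ, x, z => ∀ c : ℂ, ‖c‖ ≤ (r.1 : ℝ) → φ.Realize π x (Fin.snoc z c)

/-- The structure of `π` is a model of a set of sentences. -/
def Models (π : UnitaryRep G H) (S : Set (Formula G 0 0)) : Prop :=
  ∀ φ ∈ S, φ.Realize π ![] ![]

/-- The structure of `π` is existentially closed: whenever an existential formula with parameters
in it is true in a representation `(K, η)` on a Hilbert space that extends `(H, π)` through an
equivariant isometric linear embedding `ι`, every approximation of the formula is true in
`(H, π)`. -/
def IsExistentiallyClosed.{w', u', v'} {G : Type u'} [Group G] {H : Type v'}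
    [NormedAddCommGroup H] [InnerProductSpace ℂ H] (π : UnitaryRep G H) : Prop :=
  ∀ (K : Type w') [NormedAddCommGroup K] [InnerProductSpace ℂ K] [CompleteSpace K]
    (η : UnitaryRep G K) (ι : H →ₗᵢ[ℂ] K), (∀ g x, ι (π g x) = η g (ι x)) →
    ∀ (n m : ℕ) (φ φ' : Formula G n m), φ.IsExistential → φ.Approx φ' →
      ∀ (x : Fin n → H) (z : Fin m → ℂ),
        φ.Realize η (fun i => ι (x i)) z → φ'.Realize π x z

end Semantics

/-- `Σ_G`: the existential sentences that are true in `∞λ_G`. -/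
def sigma (G : Type u) [Group G] : Set (Formula G 0 0) :=
  {φ | φ.IsExistential ∧ φ.Realize (infRegularRep G) ![] ![]}

/-- `Σ_G⁻`: the approximations of the sentences in `Σ_G`. -/
def sigmaMinus (G : Type u) [Group G] : Set (Formula G 0 0) :=
  {φ' | ∃ φ ∈ sigma G, φ.Approx φ'}

end HilbertRep

end

noncomputable section

namespace HilbertRep

open scoped ENNReal
open Filter Topology


section Reiter

variable {G : Type u} [Group G]

/-- A form of Reiter's condition, for finitely supported probability densities: an amenable group
has finitely supported densities that are almost invariant in `ℓ¹`. -/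
theorem IsAmenable.exists_density (hG : IsAmenable G) (F : Finset G) {δ : ℝ} (hδ : 0 < δ) :
    ∃ p : G →₀ ℝ, (∀ h, 0 ≤ p h) ∧ (p.sum fun _ a => a) = 1 ∧
      ∀ g ∈ F, ∀ s : Finset G, ∑ h ∈ s, |p (g * h) - p h| ≤ δ := by
  classical
  obtain ⟨m, m_one, m_nonneg, m_inv⟩ := hG
  let e : G → lp (fun _ : G => ℝ) 1 := fun h => lp.single 1 h (1 : ℝ)
  have he : ∀ h, ‖e h‖ = 1 := fun h =>
    (lp.norm_single zero_lt_one _ _).trans norm_one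
  let D : G → (F → lp (fun _ : G => ℝ) 1) := fun h g => e ((g : G)⁻¹ * h) - e h
  have key : (0 : F → lp (fun _ : G => ℝ) 1) ∈ closure (convexHull ℝ (Set.range D)) := by
    by_contra hcon
    obtain ⟨φ, c, hc0, hc⟩ := geometric_hahn_banach_point_closed
      (convex_convexHull ℝ (Set.range D)).closure isClosed_closure hcon
    rw [map_zero] at hc0
    have hbd : ∀ (g : F) (k : G), Memℓp (fun h : G => φ (Pi.single g (e (k * h)))) ∞ := by
      intro g k
      refine memℓp_infty ⟨‖φ‖, ?_⟩
      rintro _ ⟨h, rfl⟩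
      refine (φ.le_opNorm _).trans ?_
      rw [Pi.norm_single, he, mul_one]
    let f : F → G → lp (fun _ : G => ℝ) ∞ := fun g k => ⟨_, hbd g k⟩
    have hf : ∀ g k h, f g k h = φ (Pi.single g (e (k * h))) := fun _ _ _ => rfl
    have hD : ∀ h, φ (D h) = ∑ g : F, (f g (g : G)⁻¹ h - f g 1 h) := by
      intro h
      conv_lhs => rw [← Finset.univ_sum_single (D h), map_sum]
      refine Finset.sum_congr rfl fun g _ => ?_
      rw [hf, hf, ← map_sub, ← Pi.single_sub, one_mul]
    have hpos := m_nonneg (∑ g : F, (f g (g : G)⁻¹ - f g 1) - c • 1) fun h => by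
      have h1 := hc (D h) (subset_closure (subset_convexHull ℝ _ ⟨h, rfl⟩))
      rw [hD] at h1
      rw [lp.coeFn_sub, Pi.sub_apply, lp.coeFn_sum, Finset.sum_apply, lp.coeFn_smul]
      simp only [Pi.smul_apply, lp.infty_coeFn_one, Pi.one_apply, smul_eq_mul, mul_one, sub_nonneg]
      simpa using h1.le
    rw [map_sub, map_sum, map_smul, m_one, Finset.sum_eq_zero] at hpos
    · rw [zero_sub, smul_eq_mul, mul_one] at hpos
      linarith
    · intro g _
      rw [map_sub, m_inv (g : G) (f g 1) (f g (g : G)⁻¹) fun h => by simp [hf], sub_self]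
  obtain ⟨y, hy, hyδ⟩ := Metric.mem_closure_iff.1 key δ hδ
  have hsub : convexHull ℝ (Set.range D) ⊆
      {y | ∃ p : G →₀ ℝ, (∀ h, 0 ≤ p h) ∧ (p.sum fun _ a => a) = 1 ∧
        ∀ (g : F) (h : G), y g h = p (g * h) - p h} := by
    refine convexHull_min ?_ ?_
    · rintro _ ⟨h, rfl⟩
      refine ⟨Finsupp.single h 1, fun k => ?_, by simp, fun g k => ?_⟩
      · rw [Finsupp.single_apply]; split_ifs <;> norm_num
      · simp only [D, e, lp.coeFn_sub, Pi.sub_apply, lp.single_apply, Finsupp.single_apply,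
          Pi.single_apply, eq_inv_mul_iff_mul_eq, eq_comm (a := h)]
    · rintro y ⟨p, hp0, hp1, hp⟩ z ⟨q, hq0, hq1, hq⟩ a b ha hb hab
      refine ⟨a • p + b • q, fun h => ?_, ?_, fun g h => ?_⟩
      · have := mul_nonneg ha (hp0 h)
        have := mul_nonneg hb (hq0 h)
        simp only [Finsupp.coe_add, Finsupp.coe_smul, Pi.add_apply, Pi.smul_apply, smul_eq_mul]
        positivity
      · rw [Finsupp.sum_add_index' (by simp) (by simp), Finsupp.sum_smul_index (by simp),
          Finsupp.sum_smul_index (by simp), ← Finsupp.mul_sum, ← Finsupp.mul_sum, hp1, hq1]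
        simpa using hab
      · simp only [Pi.add_apply, Pi.smul_apply, lp.coeFn_add, lp.coeFn_smul, hp, hq, smul_eq_mul,
          Finsupp.coe_add, Finsupp.coe_smul]
        ring
  obtain ⟨p, hp0, hp1, hp⟩ := hsub hy
  refine ⟨p, hp0, hp1, fun g hg s => ?_⟩
  have h1 := lp.sum_rpow_le_norm_rpow (by norm_num) (y ⟨g, hg⟩) s
  simp only [ENNReal.toReal_one, Real.rpow_one, hp, Real.norm_eq_abs] at h1
  refine h1.trans ((norm_le_pi_norm y ⟨g, hg⟩).trans ?_)
  rw [dist_zero_left] at hyδ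
  exact hyδ.le

/-- Finitely supported almost invariant unit vectors in the regular representation of an amenable
group. -/
theorem IsAmenable.exists_almost_invariant (hG : IsAmenable G) (F : Finset G) {δ : ℝ}
    (hδ : 0 < δ) :
    ∃ (s : Finset G) (ξ : G → ℝ), (∀ h ∉ s, ξ h = 0) ∧
      ∀ g ∈ F, |∑ h ∈ s, ξ (g * h) * ξ h - 1| ≤ δ := by
  classical
  obtain ⟨p, hp0, hp1, hp⟩ := hG.exists_density F hδ
  rw [Finsupp.sum] at hp1
  refine ⟨p.support, fun h => √(p h), fun h hh => ?_, fun g hg => ?_⟩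
  · simp only [Finsupp.notMem_support_iff.1 hh, Real.sqrt_zero]
  have hlow : 1 - δ ≤ ∑ h ∈ p.support, √(p (g * h)) * √(p h) := by
    calc 1 - δ ≤ ∑ h ∈ p.support, p h - ∑ h ∈ p.support, |p (g * h) - p h| := by
          rw [hp1]; linarith [hp g hg p.support]
      _ = ∑ h ∈ p.support, (p h - |p (g * h) - p h|) := by rw [Finset.sum_sub_distrib]
      _ ≤ _ := by
        refine Finset.sum_le_sum fun h _ => ?_
        rw [← Real.sqrt_mul (hp0 _)]
        have ha := hp0 (g * h)
        have hb := hp0 h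
        rcases le_total (p (g * h)) (p h) with hab | hab
        · rw [abs_of_nonpos (by linarith)]
          refine Real.le_sqrt_of_sq_le ?_
          nlinarith
        · rw [abs_of_nonneg (by linarith)]
          have : p h ≤ √(p (g * h) * p h) := Real.le_sqrt_of_sq_le (by nlinarith)
          linarith
  have hshift : ∑ h ∈ p.support, p (g * h) ≤ 1 := by
    have h1 : ∑ h ∈ p.support, p (g * h) = ∑ k ∈ p.support.image (g * ·), p k := by
      rw [Finset.sum_image fun a _ b _ hab => mul_left_cancel hab]
    rw [h1, ← hp1, Finset.sum_subset (Finset.subset_union_left (s₁ := p.support)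
      (s₂ := p.support.image (g * ·)))
      fun k _ hk => Finsupp.notMem_support_iff.1 hk]
    exact Finset.sum_le_sum_of_subset_of_nonneg Finset.subset_union_right fun k _ _ => hp0 k
  have hup : ∑ h ∈ p.support, √(p (g * h)) * √(p h) ≤ 1 := by
    calc ∑ h ∈ p.support, √(p (g * h)) * √(p h)
        ≤ ∑ h ∈ p.support, (p (g * h) + p h) / 2 := by
          refine Finset.sum_le_sum fun h _ => ?_
          nlinarith [sq_nonneg (√(p (g * h)) - √(p h)), Real.sq_sqrt (hp0 (g * h)),
            Real.sq_sqrt (hp0 h)]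
      _ ≤ 1 := by
          rw [← Finset.sum_div, Finset.sum_add_distrib]; linarith
  rw [abs_le]
  constructor <;> linarith

end Reiter


section Transfer

variable {G : Type u} [Group G] {H : Type v} [NormedAddCommGroup H] [InnerProductSpace ℂ H]
  {K : Type w} [NormedAddCommGroup K] [InnerProductSpace ℂ K]
  {π : UnitaryRep G H} {η : UnitaryRep G K}

theorem UnitaryRep.mul_apply (π : UnitaryRep G H) (g h : G) (x : H) :
    π (g * h) x = π g (π h x) := by
  rw [map_mul]; rfl

theorem UnitaryRep.inner_act_right (π : UnitaryRep G H) (g : G) (x y : H) :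
    inner ℂ x (π g y) = inner ℂ (π g⁻¹ x) y := by
  rw [← (π g⁻¹).inner_map_map x, ← π.mul_apply, inv_mul_cancel, map_one]
  rfl

variable {A : Type*} {l : Filter A} {n m : ℕ} {x : Fin n → K} {x' : A → Fin n → H}

mutual

theorem tendsto_inner_eval (z : Fin m → ℂ)
    (hx : ∀ g i j, Tendsto (fun a => inner ℂ (x' a i) (π g (x' a j))) l
      (𝓝 (inner ℂ (x i) (η g (x j))))) :
    ∀ (t : HTerm G n m) (y : K) (y' : A → H),
      (∀ g i, Tendsto (fun a => inner ℂ (y' a) (π g (x' a i))) l (𝓝 (inner ℂ y (η g (x i))))) →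
      ∀ g, Tendsto (fun a => inner ℂ (y' a) (π g (t.eval π (x' a) z))) l
        (𝓝 (inner ℂ y (η g (t.eval η x z))))
  | .var i, y, y', hy, g => by
      simpa only [HTerm.eval] using hy g i
  | .zero, y, y', hy, g => by
      simpa only [HTerm.eval, map_zero, inner_zero_right] using tendsto_const_nhds
  | .add s t, y, y', hy, g => by
      simpa only [HTerm.eval, map_add, inner_add_right] using
        (tendsto_inner_eval z hx s y y' hy g).add (tendsto_inner_eval z hx t y y' hy g)
  | .smul c t, y, y', hy, g => by
      simpa only [HTerm.eval, map_smul, inner_smul_right] using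
        (tendsto_scalar_eval z hx c).mul (tendsto_inner_eval z hx t y y' hy g)
  | .act k t, y, y', hy, g => by
      simpa only [HTerm.eval, ← UnitaryRep.mul_apply] using
        tendsto_inner_eval z hx t y y' hy (g * k)

theorem tendsto_scalar_eval (z : Fin m → ℂ)
    (hx : ∀ g i j, Tendsto (fun a => inner ℂ (x' a i) (π g (x' a j))) l
      (𝓝 (inner ℂ (x i) (η g (x j))))) :
    ∀ c : CTerm G n m, Tendsto (fun a => (c.eval π (x' a) z).down) l (𝓝 (c.eval η x z).down)
  | .var j => by
      simpa only [CTerm.eval] using tendsto_const_nhds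
  | .const q => by
      simpa only [CTerm.eval] using tendsto_const_nhds
  | .add a b => by
      simpa only [CTerm.eval] using (tendsto_scalar_eval z hx a).add (tendsto_scalar_eval z hx b)
  | .mul a b => by
      simpa only [CTerm.eval] using (tendsto_scalar_eval z hx a).mul (tendsto_scalar_eval z hx b)
  | .inner s t => by
      have hs := fun g i =>
        tendsto_inner_eval z hx s (x i) (fun a => x' a i) (fun g j => hx g i j) g
      have ht := tendsto_inner_eval z hx t (s.eval η x z) (fun a => s.eval π (x' a) z)
        (fun g i => by
          have := (Complex.continuous_conj.tendsto _).comp (hs g⁻¹ i)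
          simpa only [Function.comp_def, inner_conj_symm, UnitaryRep.inner_act_right _ g]
            using this) 1
      simpa only [CTerm.eval, map_one, LinearIsometryEquiv.coe_one, id] using ht

end

theorem tendsto_inner_eval_eval (z : Fin m → ℂ)
    (hx : ∀ g i j, Tendsto (fun a => inner ℂ (x' a i) (π g (x' a j))) l
      (𝓝 (inner ℂ (x i) (η g (x j))))) (s t : HTerm G n m) :
    Tendsto (fun a => inner ℂ (s.eval π (x' a) z) (t.eval π (x' a) z)) l
      (𝓝 (inner ℂ (s.eval η x z) (t.eval η x z))) := by
  simpa only [CTerm.eval] using tendsto_scalar_eval z hx (.inner s t)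

theorem Formula.IsQF.eventually_realize {φ φ' : Formula G n m} (hφ : φ.IsQF) (h : φ.Approx φ')
    {z : Fin m → ℂ}
    (hx : ∀ g i j, Tendsto (fun a => inner ℂ (x' a i) (π g (x' a j))) l
      (𝓝 (inner ℂ (x i) (η g (x j)))))
    (hr : φ.Realize η x z) : ∀ᶠ a in l, φ'.Realize π (x' a) z := by
  induction h with
  | innerLe s t p hε =>
    have ht := (tendsto_inner_eval_eval z hx s t).norm
    simp only [Formula.Realize] at hr ⊢
    refine (ht.eventually_lt_const (hr.trans_lt ?_)).mono fun a ha => ha.le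
    exact_mod_cast lt_add_of_pos_right p hε
  | innerGe s t q hε =>
    have ht := (tendsto_inner_eval_eval z hx s t).norm
    simp only [Formula.Realize] at hr ⊢
    rcases eq_or_ne q 0 with rfl | hq
    · simp
    · refine (ht.eventually_const_lt (lt_of_lt_of_le ?_ hr)).mono fun a ha => ha.le
      exact_mod_cast tsub_lt_self (pos_iff_ne_zero.2 hq) hε
  | and _ _ ih₁ ih₂ =>
    cases hφ with
    | and h₁ h₂ =>
      simp only [Formula.Realize] at hr ⊢
      exact (ih₁ h₁ hx hr.1).and (ih₂ h₂ hx hr.2)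
  | or _ _ ih₁ ih₂ =>
    cases hφ with
    | or h₁ h₂ =>
      simp only [Formula.Realize] at hr ⊢
      rcases hr with hr | hr
      · exact (ih₁ h₁ hx hr).mono fun _ => Or.inl
      · exact (ih₂ h₂ hx hr).mono fun _ => Or.inr
  | exH | allH | exC | allC => cases hφ

/-- If maps `T a : K → H` preserve inner products and the actions in the limit, then the
approximations of an existential formula true in `K` at `x` are eventually true in `H` at
`T a ∘ x`. -/
theorem Formula.IsExistential.eventually_realize {T : A → K → H}
    (hT : ∀ g y y', Tendsto (fun a => inner ℂ (T a y) (π g (T a y'))) l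
      (𝓝 (inner ℂ y (η g y'))))
    {n m : ℕ} {φ φ' : Formula G n m} (hφ : φ.IsExistential) (h : φ.Approx φ')
    (x : Fin n → K) (z : Fin m → ℂ) (hr : φ.Realize η x z) :
    ∀ᶠ a in l, φ'.Realize π (fun i => T a (x i)) z := by
  induction hφ with
  | qf hφ => exact hφ.eventually_realize h (fun g i j => hT g (x i) (x j)) hr
  | exH r _ ih =>
    cases h with
    | @exH _ _ _ r' hrr _ φ' h =>
    simp only [Formula.Realize] at hr ⊢
    obtain ⟨y, hy, hr⟩ := hr
    have hn : Tendsto (fun a => ‖T a y‖ ^ 2) l (𝓝 (‖y‖ ^ 2)) := by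
      have := (hT 1 y y).norm
      simpa only [map_one, LinearIsometryEquiv.coe_one, id, inner_self_eq_norm_sq_to_K, norm_pow,
        RCLike.norm_ofReal, abs_norm] using this
    have hr' : (r.1 : ℝ) < r'.1 := by exact_mod_cast hrr
    have hy' : ‖y‖ ^ 2 < (r'.1 : ℝ) ^ 2 := by
      have := norm_nonneg y
      gcongr
      linarith
    filter_upwards [ih h (Fin.snoc x y) z hr, hn.eventually_lt_const hy'] with a ha hna
    refine ⟨T a y, ?_, ?_⟩
    · refine (lt_of_pow_lt_pow_left₀ 2 ?_ hna).le
      exact_mod_cast r'.2.le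
    · convert ha using 1
      ext i
      refine Fin.lastCases ?_ (fun j => ?_) i <;> simp
  | exC r _ ih =>
    cases h with
    | exC hrr h =>
    simp only [Formula.Realize] at hr ⊢
    obtain ⟨c, hc, hr⟩ := hr
    filter_upwards [ih h x (Fin.snoc z c) hr] with a ha
    exact ⟨c, hc.trans (by exact_mod_cast hrr.le), ha⟩

end Transfer


section Sentences

variable {G : Type u}

/-- The block of existential quantifiers `∃ x₀ … x_{n-1}`, all bounded by `r`, of the Hilbert space
sort. -/
def Formula.exsH (r : {r : ℚ // 0 < r}) : (n : ℕ) → Formula G n 0 → Formula G 0 0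
  | 0, φ => φ
  | n + 1, φ => Formula.exsH r n (.exH r φ)

theorem Formula.IsExistential.exsH (r : {r : ℚ // 0 < r}) :
    ∀ {n : ℕ} {φ : Formula G n 0}, φ.IsExistential → (Formula.exsH r n φ).IsExistential
  | 0, _, h => h
  | n + 1, _, h => Formula.IsExistential.exsH r (n := n) (.exH r h)

theorem Formula.Approx.exsH {r r' : {r : ℚ // 0 < r}} (hr : r < r') :
    ∀ {n : ℕ} {φ φ' : Formula G n 0}, φ.Approx φ' →
      (Formula.exsH r n φ).Approx (Formula.exsH r' n φ')
  | 0, _, _, h => h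
  | n + 1, _, _, h => Formula.Approx.exsH hr (n := n) (.exH hr h)

/-- The conjunction, over the triples `(g, k, l)` in a list, of `|⟨x_k, g x_l⟩| ≥ q` for `g = 1` and
`k = l`, and `|⟨x_k, g x_l⟩| ≤ p` otherwise. -/
def Formula.orthonormalOrbits [Group G] [DecidableEq G] {n : ℕ} (p q : ℚ≥0) :
    List (G × Fin n × Fin n) → Formula G n 0
  | [] => .innerLe .zero .zero p
  | (g, k, l) :: L =>
    .and (if g = 1 ∧ k = l then .innerGe (.var k) (.act g (.var l)) q
      else .innerLe (.var k) (.act g (.var l)) p) (orthonormalOrbits p q L)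

variable [Group G] {n : ℕ}

variable {H : Type v} [NormedAddCommGroup H] [InnerProductSpace ℂ H]

theorem Formula.realize_exsH (π : UnitaryRep G H) (r : {r : ℚ // 0 < r}) :
    ∀ {n : ℕ} {φ : Formula G n 0}, (Formula.exsH r n φ).Realize π ![] ![] ↔
      ∃ v : Fin n → H, (∀ i, ‖v i‖ ≤ (r.1 : ℝ)) ∧ φ.Realize π v ![]
  | 0, φ => by
    refine ⟨fun h => ⟨![], fun i => i.elim0, h⟩, fun ⟨v, _, h⟩ => ?_⟩
    rwa [Subsingleton.elim v ![]] at h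
  | n + 1, φ => by
    rw [Formula.exsH, realize_exsH π r]
    simp only [Formula.Realize]
    constructor
    · rintro ⟨v, hv, y, hy, h⟩
      refine ⟨Fin.snoc v y, fun i => ?_, h⟩
      refine Fin.lastCases ?_ (fun j => ?_) i <;> simp [hy, hv]
    · rintro ⟨v, hv, h⟩
      exact ⟨Fin.init v, fun i => hv _, v (Fin.last n), hv _, by rwa [Fin.snoc_init_self]⟩

theorem infRegularRep_single (g : G) (i : ℕ) (f : L2 G) :
    infRegularRep G g (lp.single 2 i f) = lp.single 2 i (regularRep G g f) := by
  ext1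
  funext j
  change regularRep G g ((lp.single 2 i f : InfL2 G) j) = _
  rw [lp.single_apply, lp.single_apply]
  rcases eq_or_ne j i with rfl | hj
  · simp
  · simp [Pi.single_eq_of_ne hj]

variable [DecidableEq G]

theorem Formula.isQF_orthonormalOrbits (p q : ℚ≥0) :
    ∀ L : List (G × Fin n × Fin n), (Formula.orthonormalOrbits p q L).IsQF
  | [] => .innerLe _ _ _
  | (g, k, l) :: L => by
    refine .and ?_ (isQF_orthonormalOrbits p q L)
    split_ifs
    exacts [.innerGe _ _ _, .innerLe _ _ _]

theorem Formula.approx_orthonormalOrbits (p q : ℚ≥0) {ε : ℚ≥0} (hε : 0 < ε) :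
    ∀ L : List (G × Fin n × Fin n),
      (Formula.orthonormalOrbits p q L).Approx (Formula.orthonormalOrbits (p + ε) (q - ε) L)
  | [] => .innerLe _ _ _ hε
  | (g, k, l) :: L => by
    refine .and ?_ (approx_orthonormalOrbits p q hε L)
    split_ifs
    exacts [.innerGe _ _ _ hε, .innerLe _ _ _ hε]

theorem Formula.realize_orthonormalOrbits (π : UnitaryRep G H) (p q : ℚ≥0) (v : Fin n → H) :
    ∀ L : List (G × Fin n × Fin n), (Formula.orthonormalOrbits p q L).Realize π v ![] ↔
      ∀ g k l, (g, k, l) ∈ L →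
        if g = 1 ∧ k = l then (q : ℝ) ≤ ‖inner ℂ (v k) (π g (v l))‖
          else ‖inner ℂ (v k) (π g (v l))‖ ≤ p
  | [] => by simp [Formula.orthonormalOrbits, Formula.Realize, HTerm.eval, NNRat.cast_nonneg]
  | (g, k, l) :: L => by
    rw [Formula.orthonormalOrbits, Formula.Realize, realize_orthonormalOrbits π p q v L]
    have : (if g = 1 ∧ k = l then (.innerGe (.var k) (.act g (.var l)) q : Formula G n 0)
        else .innerLe (.var k) (.act g (.var l)) p).Realize π v ![] ↔
        if g = 1 ∧ k = l then (q : ℝ) ≤ ‖inner ℂ (v k) (π g (v l))‖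
          else ‖inner ℂ (v k) (π g (v l))‖ ≤ p := by
      split_ifs <;> simp [Formula.Realize, HTerm.eval]
    rw [this]
    constructor
    · rintro ⟨h, hL⟩ g' k' l' hm
      rcases List.mem_cons.1 hm with hm | hm
      · obtain ⟨rfl, rfl, rfl⟩ := by simpa only [Prod.mk.injEq] using hm
        exact h
      · exact hL _ _ _ hm
    · exact fun h =>
        ⟨h _ _ _ List.mem_cons_self, fun _ _ _ hm => h _ _ _ (List.mem_cons_of_mem _ hm)⟩

theorem regularRep_single (g h : G) (c : ℂ) :
    regularRep G g (lp.single 2 h c) = lp.single 2 (g * h) c := by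
  ext k
  change (lp.single 2 h c : L2 G) (g⁻¹ * k) = _
  simp only [lp.single_apply, Pi.single_apply, inv_mul_eq_iff_eq_mul]

theorem inner_infRegularRep_single (g : G) (i j : ℕ) :
    inner ℂ (lp.single 2 i (lp.single 2 1 1) : InfL2 G)
      (infRegularRep G g (lp.single 2 j (lp.single 2 1 1))) = if g = 1 ∧ i = j then 1 else 0 := by
  rw [infRegularRep_single, regularRep_single, mul_one, lp.inner_single_left, lp.single_apply,
    Pi.single_apply]
  by_cases hij : i = j
  · rw [if_pos hij, lp.inner_single_left, lp.single_apply, Pi.single_apply]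
    by_cases hg : g = 1
    · simp [hg, hij]
    · simp [hg, hij, Ne.symm hg]
  · simp [hij]

/-- A model of `Σ_G⁻` contains vectors whose orbits are orthonormal up to a small error. -/
theorem exists_almost_orthonormal (π : UnitaryRep G H) (hπ : Models π (sigmaMinus G)) (n : ℕ)
    (F : Finset G) {ε : ℝ} (hε : 0 < ε) :
    ∃ v : Fin n → H, ∀ g ∈ F, ∀ k l,
      ‖inner ℂ (v k) (π g (v l)) - (if g = 1 ∧ k = l then 1 else 0 : ℂ)‖ ≤ ε := by
  obtain ⟨δ, hδ0, hδ⟩ : ∃ δ : ℚ, 0 < δ ∧ (δ : ℝ) < min (ε / 3) 1 := by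
    obtain ⟨δ, h1, h2⟩ := exists_rat_btwn (show (0 : ℝ) < min (ε / 3) 1 by positivity)
    exact ⟨δ, by exact_mod_cast h1, h2⟩
  have hδε := hδ.trans_le (min_le_left _ _)
  have hδ1 := hδ.trans_le (min_le_right _ _)
  lift δ to ℚ≥0 using hδ0.le
  have hδ0' : 0 < δ := by exact_mod_cast hδ0
  replace hδε : (δ : ℝ) < ε / 3 := by exact_mod_cast hδε
  replace hδ1 : (δ : ℝ) < 1 := by exact_mod_cast hδ1
  let L : List (G × Fin n × Fin n) := (F ×ˢ (Finset.univ ×ˢ Finset.univ)).toList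
  let r : {r : ℚ // 0 < r} := ⟨1, one_pos⟩
  let r' : {r : ℚ // 0 < r} := ⟨1 + δ, by positivity⟩
  have hrr : r < r' := Subtype.mk_lt_mk.2 (lt_add_of_pos_right _ hδ0)
  have hmem : Formula.exsH r n (Formula.orthonormalOrbits 0 1 L) ∈ sigma G := by
    refine ⟨.exsH r (.qf (Formula.isQF_orthonormalOrbits _ _ _)),
      (Formula.realize_exsH _ _).2 ⟨fun k => lp.single 2 k (lp.single 2 1 1), fun k => ?_, ?_⟩⟩
    · rw [lp.norm_single (by norm_num), lp.norm_single (by norm_num)]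
      simp [r]
    · refine (Formula.realize_orthonormalOrbits _ _ _ _ _).2 fun g k l _ => ?_
      simp only [inner_infRegularRep_single, Fin.val_inj]
      split_ifs <;> simp
  obtain ⟨v, hv, hreal⟩ := (Formula.realize_exsH _ _).1
    (hπ _ ⟨_, hmem, Formula.Approx.exsH hrr (Formula.approx_orthonormalOrbits 0 1 hδ0' L)⟩)
  rw [Formula.realize_orthonormalOrbits] at hreal
  refine ⟨v, fun g hg k l => ?_⟩
  have h1 := hreal g k l (by simp [L, hg])
  have hδ0R : (0 : ℝ) < δ := by exact_mod_cast hδ0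
  split_ifs at h1 ⊢ with hgk
  · obtain ⟨rfl, rfl⟩ := hgk
    have h2 : ‖v k‖ ≤ 1 + δ := by simpa [r'] using hv k
    rw [map_one, LinearIsometryEquiv.coe_one, id, inner_self_eq_norm_sq_to_K] at h1 ⊢
    rw [norm_pow, RCLike.norm_ofReal, abs_norm] at h1
    have h1' : (1 : ℝ) - δ ≤ ((1 - δ : ℚ≥0) : ℝ) := by
      rw [sub_le_iff_le_add]
      exact_mod_cast le_tsub_add
    have h3 : ((‖v k‖ : ℂ)) ^ 2 - 1 = ((‖v k‖ ^ 2 - 1 : ℝ) : ℂ) := by push_cast; rfl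
    change ‖((‖v k‖ : ℂ)) ^ 2 - 1‖ ≤ ε
    rw [h3, Complex.norm_real, Real.norm_eq_abs, abs_le]
    have := norm_nonneg (v k)
    constructor <;> nlinarith
  · rw [sub_zero]
    rw [zero_add] at h1
    exact h1.trans (hδε.le.trans (by linarith))

end Sentences

section GramPerturbation

variable {H : Type v} [NormedAddCommGroup H] [InnerProductSpace ℂ H]

theorem norm_inner_sum_sub_le {ι : Type*} (s : Finset ι) (w w' : ι → H) (M : ι → ι → ℂ) {ε : ℝ}
    (h : ∀ i ∈ s, ∀ j ∈ s, ‖inner ℂ (w i) (w' j) - M i j‖ ≤ ε) (c d : ι → ℂ) :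
    ‖inner ℂ (∑ i ∈ s, c i • w i) (∑ j ∈ s, d j • w' j) -
      ∑ i ∈ s, ∑ j ∈ s, starRingEnd ℂ (c i) * d j * M i j‖ ≤
      ε * ((∑ i ∈ s, ‖c i‖) * ∑ j ∈ s, ‖d j‖) := by
  have : inner ℂ (∑ i ∈ s, c i • w i) (∑ j ∈ s, d j • w' j) -
      ∑ i ∈ s, ∑ j ∈ s, starRingEnd ℂ (c i) * d j * M i j =
      ∑ i ∈ s, ∑ j ∈ s, starRingEnd ℂ (c i) * d j * (inner ℂ (w i) (w' j) - M i j) := by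
    rw [sum_inner, ← Finset.sum_sub_distrib]
    refine Finset.sum_congr rfl fun i _ => ?_
    rw [inner_sum, ← Finset.sum_sub_distrib]
    refine Finset.sum_congr rfl fun j _ => ?_
    rw [inner_smul_left, inner_smul_right]
    ring
  rw [this, Finset.sum_mul_sum, Finset.mul_sum]
  refine (norm_sum_le _ _).trans (Finset.sum_le_sum fun i hi => ?_)
  rw [Finset.mul_sum]
  refine (norm_sum_le _ _).trans (Finset.sum_le_sum fun j hj => ?_)
  rw [norm_mul, norm_mul, RCLike.norm_conj, mul_comm]
  exact mul_le_mul_of_nonneg_right (h i hi j hj) (by positivity)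

/-- Bessel's inequality, up to a constant, for almost orthonormal vectors. -/
theorem sum_norm_inner_sq_le {n : ℕ} {ε : ℝ} (hε : 0 ≤ ε) (hn : ε * n ≤ 1) (v : Fin n → H)
    (hv : ∀ k l, ‖inner ℂ (v k) (v l) - (if k = l then 1 else 0 : ℂ)‖ ≤ ε) (a : H) :
    ∑ k, ‖inner ℂ a (v k)‖ ^ 2 ≤ 2 * ‖a‖ ^ 2 := by
  set S := ∑ k, ‖inner ℂ a (v k)‖ ^ 2 with hS
  let c : Fin n → ℂ := fun k => inner ℂ (v k) a
  have hc : ∀ k, ‖c k‖ = ‖inner ℂ a (v k)‖ := fun k => norm_inner_symm _ _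
  let y := ∑ k, c k • v k
  have hS0 : 0 ≤ S := Finset.sum_nonneg fun _ _ => by positivity
  have h1 : inner ℂ y a = (S : ℂ) := by
    simp only [y, sum_inner, inner_smul_left, hS, ← hc]
    push_cast
    exact Finset.sum_congr rfl fun k _ => Complex.conj_mul' (c k)
  have h2 : S ≤ ‖y‖ * ‖a‖ := by
    have := norm_inner_le_norm (𝕜 := ℂ) y a
    rwa [h1, Complex.norm_real, Real.norm_of_nonneg hS0] at this
  have h3 : ‖y‖ ^ 2 ≤ 2 * S := by
    have h := norm_inner_sum_sub_le Finset.univ v v (fun k l => if k = l then 1 else 0)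
      (fun k _ l _ => hv k l) c c
    have hsum : ∑ k, ∑ l, starRingEnd ℂ (c k) * c l * (if k = l then 1 else 0) = (S : ℂ) := by
      simp only [mul_ite, mul_one, mul_zero, Finset.sum_ite_eq, Finset.mem_univ, if_true, hS, ← hc]
      push_cast
      exact Finset.sum_congr rfl fun k _ => Complex.conj_mul' (c k)
    have hcs : (∑ k, ‖c k‖) ^ 2 ≤ n * S := by
      have := sq_sum_le_card_mul_sum_sq (s := Finset.univ) (f := fun k => ‖c k‖)
      simpa only [Finset.card_univ, Fintype.card_fin, hc] using this
    rw [hsum] at h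
    have h4 := norm_le_norm_add_norm_sub' (inner ℂ y y) (S : ℂ)
    rw [inner_self_eq_norm_sq_to_K, norm_pow, RCLike.norm_ofReal, abs_norm, Complex.norm_real,
      Real.norm_of_nonneg hS0, ← inner_self_eq_norm_sq_to_K (𝕜 := ℂ)] at h4
    have h5 : ε * ((∑ k, ‖c k‖) * ∑ k, ‖c k‖) ≤ S := by
      rw [← pow_two]
      calc ε * (∑ k, ‖c k‖) ^ 2 ≤ ε * (n * S) := by gcongr
        _ = (ε * n) * S := by ring
        _ ≤ 1 * S := by gcongr
        _ = S := one_mul S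
    have h6 := h.trans h5
    change ‖inner ℂ y y - (S : ℂ)‖ ≤ S at h6
    linarith
  by_contra! hcon
  have h4 : S ^ 2 ≤ ‖y‖ ^ 2 * ‖a‖ ^ 2 := by rw [← mul_pow]; gcongr
  have := norm_nonneg a
  nlinarith [sq_nonneg ‖a‖]

/-- The almost orthonormal orbits in a model of `Σ_G⁻` can be chosen almost orthogonal to finitely
many given vectors. -/
theorem exists_almost_orthonormal_orthogonal {G : Type u} [Group G] [DecidableEq G]
    (π : UnitaryRep G H) (hπ : Models π (sigmaMinus G)) (n : ℕ) (F : Finset G) (X : Finset H)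
    {ε : ℝ} (hε : 0 < ε) :
    ∃ v : Fin n → H, (∀ g ∈ F, ∀ k l,
      ‖inner ℂ (v k) (π g (v l)) - (if g = 1 ∧ k = l then 1 else 0 : ℂ)‖ ≤ ε) ∧
      ∀ x ∈ X, ∀ k, ‖inner ℂ x (v k)‖ ≤ ε := by
  classical
  obtain ⟨B, hB⟩ := exists_nat_ge ((∑ x ∈ X, 2 * ‖x‖ ^ 2) / ε ^ 2)
  rw [div_le_iff₀ (by positivity)] at hB
  set δ := min ε (1 / ((n + B : ℕ) + 1)) with hδ
  have hδ0 : 0 < δ := by positivity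
  have hδn : δ * (n + B : ℕ) ≤ 1 := by
    have h1 : δ ≤ 1 / ((n + B : ℕ) + 1) := min_le_right _ _
    rw [le_div_iff₀ (by positivity)] at h1
    linarith
  obtain ⟨v, hv⟩ := exists_almost_orthonormal π hπ (n + B) (insert 1 F) hδ0
  have hbes : ∀ x, ∑ k, ‖inner ℂ x (v k)‖ ^ 2 ≤ 2 * ‖x‖ ^ 2 :=
    sum_norm_inner_sq_le hδ0.le hδn v fun k l => by
      simpa using hv 1 (Finset.mem_insert_self _ _) k l
  let bad : Finset (Fin (n + B)) := {k | ∃ x ∈ X, ε < ‖inner ℂ x (v k)‖}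
  have hbad : bad.card ≤ B := by
    have h1 : bad.card * ε ^ 2 ≤ B * ε ^ 2 := by
      calc bad.card * ε ^ 2 = ∑ k ∈ bad, ε ^ 2 := by simp
        _ ≤ ∑ k ∈ bad, ∑ x ∈ X, ‖inner ℂ x (v k)‖ ^ 2 := by
          refine Finset.sum_le_sum fun k hk => ?_
          obtain ⟨x, hx, hxk⟩ := (Finset.mem_filter.1 hk).2
          refine le_trans ?_ (Finset.single_le_sum
            (f := fun x => ‖inner ℂ x (v k)‖ ^ 2) (fun _ _ => by positivity) hx)
          gcongr
        _ ≤ ∑ k, ∑ x ∈ X, ‖inner ℂ x (v k)‖ ^ 2 :=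
          Finset.sum_le_sum_of_subset_of_nonneg (Finset.subset_univ _)
            fun _ _ _ => by positivity
        _ = ∑ x ∈ X, ∑ k, ‖inner ℂ x (v k)‖ ^ 2 := Finset.sum_comm
        _ ≤ ∑ x ∈ X, 2 * ‖x‖ ^ 2 := Finset.sum_le_sum fun x _ => hbes x
        _ ≤ B * ε ^ 2 := hB
    exact_mod_cast le_of_mul_le_mul_right h1 (by positivity)
  have hgood : n ≤ badᶜ.card := by
    rw [Finset.card_compl, Fintype.card_fin]; omega
  refine ⟨fun k => v (badᶜ.orderEmbOfCardLe hgood k), fun g hg k l => ?_, fun x hx k => ?_⟩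
  · simpa using (hv g (Finset.mem_insert_of_mem hg) (badᶜ.orderEmbOfCardLe hgood k)
      (badᶜ.orderEmbOfCardLe hgood l)).trans (min_le_left _ _)
  · have := Finset.orderEmbOfCardLe_mem badᶜ hgood k
    simp only [bad, Finset.mem_compl, Finset.mem_filter, Finset.mem_univ, true_and, not_exists,
      not_and, not_lt] at this
    exact this x hx

end GramPerturbation


section WeakContainment

variable {G : Type u} [Group G] {H : Type v} [NormedAddCommGroup H] [InnerProductSpace ℂ H]
  {K : Type w} [NormedAddCommGroup K] [InnerProductSpace ℂ K]

/-- Finitely many vectors span a subspace with a finite orthonormal basis. -/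
theorem exists_sum_inner_mul_inner (E : Finset K) :
    ∃ (N : ℕ) (b : Fin N → K), ∀ x ∈ E, ∀ y ∈ E,
      ∑ k, inner ℂ x (b k) * inner ℂ (b k) y = inner ℂ x y := by
  let W : Submodule ℂ K := Submodule.span ℂ E
  let b := stdOrthonormalBasis ℂ W
  refine ⟨_, fun k => (b k : K), fun x hx y hy => ?_⟩
  exact b.sum_inner_mul_inner ⟨x, Submodule.subset_span hx⟩ ⟨y, Submodule.subset_span hy⟩

/-- If `G` is amenable then every representation of `G` is weakly contained in each model of
`Σ_G⁻`, even approximately orthogonally to finitely many given vectors. -/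
theorem exists_almost_equivariant (hG : IsAmenable G) (π : UnitaryRep G H)
    (hπ : Models π (sigmaMinus G)) (η : UnitaryRep G K) (F : Finset G) (E : Finset K)
    (X : Finset H) {ε : ℝ} (hε : 0 < ε) :
    ∃ S : K → H, S 0 = 0 ∧
      (∀ g ∈ F, ∀ e ∈ E, ∀ e' ∈ E,
        ‖inner ℂ (S e) (π g (S e')) - inner ℂ e (η g e')‖ ≤ ε) ∧
      ∀ x ∈ X, ∀ e ∈ E, ‖inner ℂ x (S e)‖ ≤ ε := by
  classical
  obtain ⟨C, hC0, hC⟩ : ∃ C : ℝ, 0 < C ∧ ∀ e ∈ E, ‖e‖ ≤ C :=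
    ⟨∑ e ∈ E, ‖e‖ + 1, by positivity, fun e he =>
      (Finset.single_le_sum (f := fun e : K => ‖e‖) (fun _ _ => norm_nonneg _) he).trans
        (by simp)⟩
  obtain ⟨s, ξ, hξs, hξ⟩ := hG.exists_almost_invariant F (δ := ε / 2 / (C * C)) (by positivity)
  obtain ⟨N, b, hb⟩ := exists_sum_inner_mul_inner
    ((s ×ˢ E).image fun q => η q.1⁻¹ q.2)
  let c : K → G × Fin N → ℂ := fun e q => ξ q.1 * inner ℂ (b q.2) (η q.1⁻¹ e)
  let t : Finset (G × Fin N) := s ×ˢ Finset.univ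
  let D : ℝ := ∑ e ∈ E, ∑ q ∈ t, ‖c e q‖ + 1
  have hD1 : 1 ≤ D := by
    have : 0 ≤ ∑ e ∈ E, ∑ q ∈ t, ‖c e q‖ := by positivity
    simp only [D]; linarith
  have hD : ∀ e ∈ E, ∑ q ∈ t, ‖c e q‖ ≤ D := fun e he =>
    (Finset.single_le_sum (f := fun e => ∑ q ∈ t, ‖c e q‖) (fun _ _ => by positivity) he).trans
      (by simp [D])
  obtain ⟨v, hv, hvX⟩ := exists_almost_orthonormal_orthogonal π hπ N
    ((s ×ˢ F ×ˢ s).image fun q => q.1⁻¹ * q.2.1 * q.2.2)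
    ((s ×ˢ X).image fun q => π q.1⁻¹ q.2) (ε := ε / 2 / (D * D)) (by positivity)
  let S : K → H := fun e => ∑ q ∈ t, c e q • π q.1 (v q.2)
  refine ⟨S, by simp [S, c], fun g hg e he e' he' => ?_, fun x hx e he => ?_⟩
  · have hmain := norm_inner_sum_sub_le t (fun q => π q.1 (v q.2))
      (fun q => π g (π q.1 (v q.2))) (fun q q' => if q.1 = g * q'.1 ∧ q.2 = q'.2 then 1 else 0)
      (ε := ε / 2 / (D * D)) (fun q hq q' hq' => by
        have h1 := hv (q.1⁻¹ * g * q'.1) (Finset.mem_image.2 ⟨(q.1, g, q'.1), by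
          simp only [Finset.mem_product, t, Finset.mem_univ, and_true] at hq hq' ⊢
          exact ⟨hq, hg, hq'⟩, rfl⟩) q.2 q'.2
        rw [mul_assoc, inv_mul_eq_one, π.mul_apply, π.inner_act_right, inv_inv, π.mul_apply] at h1
        exact h1) (c e) (c e')
    have hS : π g (S e') = ∑ q ∈ t, c e' q • π g (π q.1 (v q.2)) := by
      simp only [S, map_sum, map_smul]
    rw [← hS] at hmain
    have hsum : ∑ q ∈ t, ∑ q' ∈ t, starRingEnd ℂ (c e q) * c e' q' *
        (if q.1 = g * q'.1 ∧ q.2 = q'.2 then 1 else 0) =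
        ((∑ h ∈ s, ξ (g * h) * ξ h : ℝ) : ℂ) * inner ℂ e (η g e') := by
      have h1 : ∀ q' ∈ t, ∑ q ∈ t, starRingEnd ℂ (c e q) * c e' q' *
          (if q.1 = g * q'.1 ∧ q.2 = q'.2 then 1 else 0) =
          starRingEnd ℂ (c e (g * q'.1, q'.2)) * c e' q' := by
        intro q' _
        have h2 : ∀ q : G × Fin N, (q.1 = g * q'.1 ∧ q.2 = q'.2) ↔ q = (g * q'.1, q'.2) :=
          fun q => (Prod.ext_iff (y := (g * q'.1, q'.2))).symm
        simp only [h2, mul_ite, mul_one, mul_zero, Finset.sum_ite_eq', ite_eq_left_iff]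
        intro hq
        have : g * q'.1 ∉ s := by simpa [t] using hq
        simp [c, hξs _ this]
      rw [Finset.sum_comm, Finset.sum_congr rfl h1, Finset.sum_product, Complex.ofReal_sum,
        Finset.sum_mul]
      refine Finset.sum_congr rfl fun h hh => ?_
      by_cases hgh : g * h ∈ s
      · have h3 := hb (η (g * h)⁻¹ e) (Finset.mem_image.2 ⟨(g * h, e), by simp [hgh, he], rfl⟩)
          (η h⁻¹ e') (Finset.mem_image.2 ⟨(h, e'), by simp [hh, he'], rfl⟩)
        rw [← η.inner_act_right, ← η.mul_apply, mul_inv_cancel_right] at h3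
        rw [← h3, Finset.mul_sum]
        refine Finset.sum_congr rfl fun k _ => ?_
        simp only [c, map_mul, Complex.conj_ofReal, inner_conj_symm]
        push_cast
        ring
      · simp [c, hξs _ hgh]
    rw [hsum] at hmain
    have h4 : ‖((∑ h ∈ s, ξ (g * h) * ξ h : ℝ) : ℂ) * inner ℂ e (η g e') - inner ℂ e (η g e')‖
        ≤ ε / 2 := by
      rw [← sub_one_mul, norm_mul, ← Complex.ofReal_one, ← Complex.ofReal_sub, Complex.norm_real,
        Real.norm_eq_abs]
      have h5 : ‖inner ℂ e (η g e')‖ ≤ C * C := by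
        refine (norm_inner_le_norm _ _).trans ?_
        rw [LinearIsometryEquiv.norm_map]
        exact mul_le_mul (hC e he) (hC e' he') (norm_nonneg _) hC0.le
      calc _ ≤ ε / 2 / (C * C) * (C * C) :=
            mul_le_mul (hξ g hg) h5 (norm_nonneg _) (by positivity)
        _ = ε / 2 := div_mul_cancel₀ _ (by positivity)
    have h6 : ε / 2 / (D * D) * ((∑ q ∈ t, ‖c e q‖) * ∑ q ∈ t, ‖c e' q‖) ≤ ε / 2 := by
      calc _ ≤ ε / 2 / (D * D) * (D * D) := by
            gcongr
            exacts [hD e he, hD e' he']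
        _ = ε / 2 := div_mul_cancel₀ _ (by positivity)
    calc _ ≤ _ := norm_sub_le_norm_sub_add_norm_sub _
            (((∑ h ∈ s, ξ (g * h) * ξ h : ℝ) : ℂ) * inner ℂ e (η g e')) _
      _ ≤ ε / 2 + ε / 2 := add_le_add (hmain.trans h6) h4
      _ = ε := add_halves ε
  · have h1 : ‖inner ℂ x (S e)‖ ≤ ∑ q ∈ t, ‖c e q‖ * (ε / 2 / (D * D)) := by
      simp only [S, inner_sum, inner_smul_right]
      refine (norm_sum_le _ _).trans (Finset.sum_le_sum fun q hq => ?_)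
      rw [norm_mul, π.inner_act_right]
      refine mul_le_mul_of_nonneg_left (hvX _ (Finset.mem_image.2 ⟨(q.1, x), ?_, rfl⟩) _)
        (norm_nonneg _)
      simp only [Finset.mem_product, t, Finset.mem_univ, and_true] at hq ⊢
      exact ⟨hq, hx⟩
    rw [← Finset.sum_mul] at h1
    calc _ ≤ _ := h1
      _ ≤ (D * D) * (ε / 2 / (D * D)) := by
          gcongr
          exact (hD e he).trans (by nlinarith)
      _ = ε / 2 := mul_div_cancel₀ _ (by positivity)
      _ ≤ ε := by linarith

/-- If `G` is amenable, an extension of a model `(H, π)` of `Σ_G⁻` maps back to `H`, by maps that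
fix `H` and almost preserve finitely many matrix coefficients. -/
theorem exists_almost_retraction [CompleteSpace H] (hG : IsAmenable G) (π : UnitaryRep G H)
    (hπ : Models π (sigmaMinus G)) (η : UnitaryRep G K) (ι : H →ₗᵢ[ℂ] K)
    (hι : ∀ g x, ι (π g x) = η g (ι x)) (F : Finset G) (E : Finset K) {ε : ℝ} (hε : 0 < ε) :
    ∃ T : K → H, (∀ x, T (ι x) = x) ∧ ∀ g ∈ F, ∀ e ∈ E, ∀ e' ∈ E,
      ‖inner ℂ (T e) (π g (T e')) - inner ℂ e (η g e')‖ ≤ ε := by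
  classical
  let R : Submodule ℂ K := ι.toLinearMap.range
  have hR : IsComplete (R : Set K) := ι.isometry.isUniformInducing.isComplete_range
  have : CompleteSpace R := hR.completeSpace_coe
  have hex : ∀ y : K, ∃ x : H, ∀ x', inner ℂ (ι x') (y - ι x) = 0 := by
    intro y
    obtain ⟨x, hx⟩ := (R.orthogonalProjectionOnto y).2
    refine ⟨x, fun x' => ?_⟩
    have h1 := R.sub_starProjection_mem_orthogonal y
    have h2 : ι x = R.starProjection y := hx
    rw [h2]
    exact (Submodule.mem_orthogonal _ _).1 h1 _ ⟨x', rfl⟩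
  choose P hP using hex
  have hPι : ∀ x, P (ι x) = x := fun x => by
    have h1 := hP (ι x) (x - P (ι x))
    rw [← map_sub, ι.inner_map_map, inner_self_eq_zero, sub_eq_zero] at h1
    exact h1.symm
  let Q : K → K := fun y => y - ι (P y)
  obtain ⟨S, hS0, hS, hSX⟩ := exists_almost_equivariant hG π hπ η F (E.image Q)
    ((F ×ˢ E).image (fun q => π q.1 (P q.2)) ∪ (F ×ˢ E).image fun q => π q.1⁻¹ (P q.2))
    (ε := ε / 3) (by positivity)
  refine ⟨fun y => P y + S (Q y), fun x => ?_, fun g hg e he e' he' => ?_⟩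
  · simp only [Q, hPι, sub_self, hS0, add_zero]
  · have h1 := hS g hg _ (Finset.mem_image_of_mem Q he) _ (Finset.mem_image_of_mem Q he')
    have h2 := hSX (π g⁻¹ (P e)) (Finset.mem_union_right _
      (Finset.mem_image.2 ⟨(g, e), by simp [hg, he], rfl⟩)) _ (Finset.mem_image_of_mem Q he')
    have h3 := hSX (π g (P e')) (Finset.mem_union_left _
      (Finset.mem_image.2 ⟨(g, e'), by simp [hg, he'], rfl⟩)) _ (Finset.mem_image_of_mem Q he)
    rw [norm_inner_symm] at h3
    rw [← π.inner_act_right] at h2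
    have hdec : ∀ y, y = ι (P y) + Q y := fun y => by simp [Q]
    have hη : inner ℂ e (η g e') = inner ℂ (P e) (π g (P e')) + inner ℂ (Q e) (η g (Q e')) := by
      have h4 : inner ℂ (ι (P e)) (η g (Q e')) = 0 := by
        rw [η.inner_act_right, ← hι]; exact hP _ _
      have h5 : inner ℂ (Q e) (η g (ι (P e'))) = 0 := by
        rw [← hι, ← inner_conj_symm, hP, map_zero]
      conv_lhs => rw [hdec e, hdec e']
      rw [map_add, inner_add_left, inner_add_right, inner_add_right, h4, h5, ← hι,
        ι.inner_map_map, add_zero, zero_add]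
    have hsplit : inner ℂ (P e + S (Q e)) (π g (P e' + S (Q e'))) - inner ℂ e (η g e') =
        (inner ℂ (S (Q e)) (π g (S (Q e'))) - inner ℂ (Q e) (η g (Q e'))) +
          inner ℂ (P e) (π g (S (Q e'))) + inner ℂ (S (Q e)) (π g (P e')) := by
      rw [hη, map_add]
      simp only [inner_add_left, inner_add_right]
      ring
    rw [hsplit]
    refine (norm_add₃_le).trans ?_
    linarith

theorem isExistentiallyClosed_of_models [CompleteSpace H] (hG : IsAmenable G) (π : UnitaryRep G H)
    (hπ : Models π (sigmaMinus G)) : IsExistentiallyClosed.{w} π := by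
  classical
  intro K _ _ _ η ι hι n m φ φ' hφ hφ' x z hr
  choose T hTι hT using fun q : Finset G × Finset K × ℕ =>
    exists_almost_retraction hG π hπ η ι hι q.1 q.2.1 (ε := 1 / (q.2.2 + 1))
      Nat.one_div_pos_of_nat
  have htend : ∀ g y y', Tendsto (fun a => inner ℂ (T a y) (π g (T a y'))) atTop
      (𝓝 (inner ℂ y (η g y'))) := by
    intro g y y'
    refine Metric.tendsto_atTop.2 fun ε hε => ?_
    obtain ⟨N, hN⟩ := exists_nat_one_div_lt hε
    refine ⟨({g}, {y, y'}, N), fun a ha => ?_⟩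
    obtain ⟨h1, h2, h3⟩ : {g} ≤ a.1 ∧ {y, y'} ≤ a.2.1 ∧ N ≤ a.2.2 := ha
    rw [dist_eq_norm]
    refine ((hT a g (h1 (by simp)) y (h2 (by simp)) y' (h2 (by simp))).trans ?_).trans_lt hN
    exact Nat.one_div_le_one_div h3
  obtain ⟨a, ha⟩ := (hφ.eventually_realize htend hφ' _ z hr).exists
  simpa only [hTι] using ha

end WeakContainment

end HilbertRep

end

theorem mainTheorem4 {G : Type u} [Group G] [Countable G]
    (hG : HilbertRep.IsAmenable G)
    {H : Type v} [NormedAddCommGroup H] [InnerProductSpace ℂ H] [CompleteSpace H]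
    (π : HilbertRep.UnitaryRep G H)
    (hπ : HilbertRep.Models π (HilbertRep.sigmaMinus G)) :
    HilbertRep.IsExistentiallyClosed.{w} π := HilbertRep.isExistentiallyClosed_of_models hG π hπ
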